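/- Let $S$ be a separated noetherian scheme and let $Sm_S$ be the category of smooth separated schemes of finite type over $S$ and all $S$-morphisms, with the Nisnevich topology (a sieve on $X$ is covering if every point $x\in X$ is the image, under some étale morphism $U\to X$ of the sieve, of a point $u\in U$ with $\kappa(x)\cong\kappa(u)$). A *ringoid* over $S$ is a preadditive category $Cor$ (for instance, an additive category) with the same objects as $Sm_S$, together with a functor $\gamma\colon Sm_S\to Cor$ that is the identity on objects. For $X\in Sm_S$ and $x\in X$ let $X^h_x$ be the pro-object "$\varprojlim$" $X'$, where $X'$ runs over the Nisnevich neighbourhoods of $x$ in $X$ (étale $X'\to X$ in $Sm_S$ with a point $x'\mapsto x$ such that $\kappa(x)\cong\kappa(x')$). For $W,X\in Sm_S$, $p\in W$, $x\in X$ put $$Cor(W^h_p,X)=\varinjlim_{W'}Cor(W',X),\qquad Cor(W^h_p,X^h_x)=\varprojlim_{X'}\varinjlim_{W'}Cor(W',X'),$$ where $W'$ and $X'$ run over the Nisnevich neighbourhoods of $p$ in $W$ and of $x$ in $X$. The ringoid satisfies (NL) if for all $W,X\in Sm_S$ and $p\in W$ the canonical map $$\bigoplus_{x\in X}Cor(W^h_p,X^h_x)\longrightarrow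 Cor(W^h_p,X)$$ (the sum being over all points of the scheme $X$) is an isomorphism. A *presheaf with transfers* is an additive functor $F\colon Cor^{op}\to Ab$; its underlying presheaf is $F\circ\gamma^{op}$ on $Sm_S$. A *transfer structure* on a presheaf of abelian groups $P$ on $Sm_S$ is an additive functor $Cor^{op}\to Ab$ whose underlying presheaf is $P$. For a presheaf with transfers $F$ let $\nu\colon F\circ\gamma^{op}\to F_{nis}$ be the canonical map to the Nisnevich sheaf associated with the underlying presheaf of $F$. **Proposition.** If the ringoid $Cor$ satisfies (NL), then for every presheaf with transfers $F$ there is a unique transfer structure on $F_{nis}$ such that $\nu\colon F\to F_{nis}$ is a morphism of presheaves with transfers. -/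

import Mathlib

open CategoryTheory AlgebraicGeometry Opposite Limits DirectSum

universe v w u

noncomputable section

namespace NisTransfers

/-! ### Smooth schemes over a base -/

/-- Morphisms that are smooth, separated and of finite type (local finite type is part of
smoothness). -/
def smoothSepFT : MorphismProperty Scheme.{u} := fun _ _ f =>
  Smooth f ∧ IsSeparated f ∧ QuasiCompact f

/-- The category of smooth separated schemes of finite type over `S`, with all
`S`-morphisms. -/
abbrev Sm (S : Scheme.{u}) : Type (u + 1) := smoothSepFT.{u}.Over ⊤ S

variable {S : Scheme.{u}}

/-- `f` is étale and induces an isomorphism of residue fields `κ(f y) ≅ κ(y)` at `y`. -/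
structure IsNisAt {X Y : Scheme.{u}} (f : Y ⟶ X) (y : Y) : Prop where
  etale : Etale f
  residue : IsIso (f.residueFieldMap y)

/-! ### The Nisnevich topology -/

lemma isIso_of_surjective_residueFieldMap {X Y : Scheme.{u}} (f : Y ⟶ X) (y : Y)
    (h : Function.Surjective (f.residueFieldMap y)) : IsIso (f.residueFieldMap y) :=
  (ConcreteCategory.isIso_iff_bijective _).2 ⟨(f.residueFieldMap y).hom.injective, h⟩

lemma surjective_residueFieldMap {X Y : Scheme.{u}} (f : Y ⟶ X) [SurjectiveOnStalks f] (y : Y) :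
    Function.Surjective (f.residueFieldMap y) := by
  intro b
  obtain ⟨b, rfl⟩ := Y.residue_surjective y b
  obtain ⟨a, rfl⟩ := f.stalkMap_surjective y b
  refine ⟨X.residue _ a, ?_⟩
  have := Scheme.residue_residueFieldMap f y
  exact congrArg (fun g => g.hom a) this

/-- A point with trivial residue field extension above `x` is the same as a lift of
`Spec κ(x)`. -/
lemma exists_residue_iff {X Y : Scheme.{u}} (f : Y ⟶ X) (x : X) :
    (∃ y : Y, f y = x ∧ IsIso (f.residueFieldMap y)) ↔
      ∃ s : Spec (X.residueField x) ⟶ Y, s ≫ f = X.fromSpecResidueField x := by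
  constructor
  · rintro ⟨y, rfl, hy⟩
    refine ⟨Spec.map (inv (f.residueFieldMap y)) ≫ Y.fromSpecResidueField y, ?_⟩
    rw [Category.assoc, ← f.SpecMap_residueFieldMap_fromSpecResidueField y, ← Spec.map_comp_assoc]
    simp
  · rintro ⟨s, hs⟩
    let t : Spec (X.residueField x) := IsLocalRing.closedPoint (X.residueField x)
    refine ⟨s t, ?_, ?_⟩
    · rw [← Scheme.Hom.comp_apply, hs, Scheme.fromSpecResidueField_apply]
    · have h1 : Function.Surjective ((s ≫ f).residueFieldMap t) := by
        rw [hs]; exact surjective_residueFieldMap _ _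
      rw [Scheme.residueFieldMap_comp] at h1
      have h2 : Function.Surjective (s.residueFieldMap t) := by
        intro b
        obtain ⟨a, ha⟩ := h1 b
        exact ⟨f.residueFieldMap (s t) a, ha⟩
      apply isIso_of_surjective_residueFieldMap
      intro b
      obtain ⟨a, ha⟩ := h1 (s.residueFieldMap t b)
      refine ⟨a, (s.residueFieldMap t).hom.injective ha⟩

/-- The Nisnevich topology on `Sm S`: a sieve on `X` is covering if every point `x` of the scheme
`X` is the image, under some étale morphism of the sieve, of a point with the same residue
field. -/
def nisnevichTopology (S : Scheme.{u}) : GrothendieckTopology (Sm S) where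
  sieves X := {R | ∀ x : X.left, ∃ (U : Sm S) (f : U ⟶ X) (p : U.left),
    R f ∧ f.left p = x ∧ IsNisAt f.left p}
  top_mem' X x := ⟨X, 𝟙 X, x, trivial, by simp,
    ⟨by change Etale (𝟙 X.left); infer_instance,
      by change IsIso ((𝟙 X.left : X.left ⟶ X.left).residueFieldMap x); infer_instance⟩⟩
  pullback_stable' X Y R g hR y := by
    obtain ⟨U, f, p, hf, hp, he, hr⟩ := hR (g.left y)
    obtain ⟨s, hs⟩ := (exists_residue_iff f.left (g.left y)).1 ⟨p, hp, hr⟩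
    let q : pullback g.left f.left ⟶ Y.left := pullback.fst g.left f.left
    have hX : IsSeparated X.hom ∧ QuasiCompact X.hom := X.prop.2
    have hU : IsSeparated U.hom ∧ QuasiCompact U.hom := U.prop.2
    have hY : Smooth Y.hom ∧ IsSeparated Y.hom ∧ QuasiCompact Y.hom := Y.prop
    have := hX.1
    have := hY.1
    have := hY.2.1
    have := hY.2.2
    have hw : f.left ≫ X.hom = U.hom := MorphismProperty.Over.w f
    have h1 : IsSeparated f.left := by
      have : IsSeparated (f.left ≫ X.hom) := by rw [hw]; exact hU.1
      exact .of_comp _ X.hom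
    have h2 : QuasiCompact f.left := by
      have : QuasiCompact (f.left ≫ X.hom) := by rw [hw]; exact hU.2
      exact .of_comp _ X.hom
    have hq : smoothSepFT (q ≫ Y.hom) :=
      ⟨by dsimp only [q]; infer_instance, by dsimp only [q]; infer_instance,
        by dsimp only [q]; infer_instance⟩
    have hlift : Y.left.fromSpecResidueField y ≫ g.left =
        (Spec.map (g.left.residueFieldMap y) ≫ s) ≫ f.left := by
      rw [Category.assoc, hs, Scheme.Hom.SpecMap_residueFieldMap_fromSpecResidueField]
    obtain ⟨z, hz, hzr⟩ := (exists_residue_iff q y).2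
      ⟨pullback.lift (Y.left.fromSpecResidueField y)
        (Spec.map (g.left.residueFieldMap y) ≫ s) hlift, pullback.lift_fst _ _ _⟩
    let P : Sm S := MorphismProperty.Over.mk ⊤ (q ≫ Y.hom) hq
    let a : P ⟶ Y := MorphismProperty.Over.homMk q rfl trivial
    have hgw : g.left ≫ X.hom = Y.hom := MorphismProperty.Over.w g
    let b : P ⟶ U := MorphismProperty.Over.homMk (pullback.snd g.left f.left)
      (by
        change pullback.snd g.left f.left ≫ U.hom = pullback.fst g.left f.left ≫ Y.hom
        rw [← hw, ← hgw, pullback.condition_assoc]) trivial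
    have hab : a ≫ g = b ≫ f := by
      ext
      exact pullback.condition
    refine ⟨P, a, z, ?_, hz, ⟨by change Etale q; dsimp only [q]; infer_instance, hzr⟩⟩
    rw [Sieve.pullback_apply, hab]
    exact R.downward_closed hf b
  transitive' X R hR T hT x := by
    obtain ⟨U, f, p, hf, hp, he, hr⟩ := hR x
    obtain ⟨V, g, q, hg, hq, he', hr'⟩ := hT hf p
    subst hp
    subst hq
    refine ⟨V, g ≫ f, q, hg, by simp, ⟨?_, ?_⟩⟩
    · change Etale (g.left ≫ f.left)
      infer_instance
    · change IsIso ((g.left ≫ f.left).residueFieldMap q)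
      rw [Scheme.residueFieldMap_comp]
      exact IsIso.comp_isIso' hr hr'

/-- Sheafification of presheaves of abelian groups exists, by passing to a small model of
`Sm S`. -/
instance (S : Scheme.{u}) :
    HasSheafify (nisnevichTopology S) AddCommGrpCat.{max v (u + 1)} := by
  have : HasSheafify
      ((equivSmallModel.{max v (u + 1)} (Sm S)).inverse.inducedTopology (nisnevichTopology S))
      AddCommGrpCat.{max v (u + 1)} := inferInstance
  exact (equivSmallModel.{max v (u + 1)} (Sm S)).hasSheafify (nisnevichTopology S)
    ((equivSmallModel.{max v (u + 1)} (Sm S)).inverse.inducedTopology (nisnevichTopology S)) _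

/-! ### Nisnevich neighbourhoods and Henselian local schemes

The Henselian local scheme `X^h_x` is the pro-object given by the cofiltered system of
Nisnevich neighbourhoods of `x` in `X`. -/

/-- A Nisnevich neighbourhood of the point `x` of `X`: an étale `U ⟶ X` in `Sm S` with a point
above `x` with the same residue field. -/
structure NisNbhd (X : Sm S) (x : X.left) where
  obj : Sm S
  map : obj ⟶ X
  pt : obj.left
  map_pt : map.left pt = x
  isNisAt : IsNisAt map.left pt

namespace NisNbhd

variable {X : Sm S} {x : X.left}

/-- Morphisms of Nisnevich neighbourhoods: pointed morphisms over `X`. -/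
@[ext]
structure Hom (A B : NisNbhd X x) where
  hom : A.obj ⟶ B.obj
  w : hom ≫ B.map = A.map
  hom_pt : hom.left A.pt = B.pt

instance : Category (NisNbhd X x) where
  Hom := Hom
  id A := ⟨𝟙 A.obj, by simp, by simp⟩
  comp f g := ⟨f.hom ≫ g.hom, by rw [Category.assoc, g.w, f.w], by
    simp [f.hom_pt, g.hom_pt]⟩
  id_comp f := Hom.ext (Category.id_comp _)
  comp_id f := Hom.ext (Category.comp_id _)
  assoc f g h := Hom.ext (Category.assoc _ _ _)

variable (X x)

/-- The forgetful functor, i.e. the pro-object `X^h_x`. -/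
def forget : NisNbhd X x ⥤ Sm S where
  obj A := A.obj
  map f := f.hom

/-- The trivial neighbourhood `X` itself. -/
def trivial : NisNbhd X x :=
  ⟨X, 𝟙 X, x, by simp,
    ⟨by change Etale (𝟙 X.left); infer_instance,
      by change IsIso ((𝟙 X.left : X.left ⟶ X.left).residueFieldMap x); infer_instance⟩⟩

end NisNbhd

/-- The value `colim P(U)` of presheaves of abelian groups on the Henselian local scheme `X^h_x`,
the colimit being over the Nisnevich neighbourhoods `U` of `x`. The groups are lifted to a
universe in which this colimit exists. -/
def stalkFunctor (X : Sm S) (x : X.left) :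
    ((Sm S)ᵒᵖ ⥤ AddCommGrpCat.{w}) ⥤ AddCommGrpCat.{max w (u + 1)} :=
  (Functor.whiskeringLeft _ _ _).obj (NisNbhd.forget X x).op ⋙
    (Functor.whiskeringRight _ _ _).obj AddCommGrpCat.uliftFunctor.{u + 1, w} ⋙ colim

/-! ### Ringoids (categories of correspondences) -/

/-- A ringoid over `S`: a preadditive category whose objects are those of `Sm S`, with a
functor from `Sm S` which is the identity on objects. -/
structure Ringoid (S : Scheme.{u}) where
  /-- the correspondences from `X` to `Y` -/
  Hom : Sm S → Sm S → Type w
  [addCommGroup : ∀ X Y, AddCommGroup (Hom X Y)]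
  id : ∀ X, Hom X X
  comp : ∀ {X Y Z}, Hom X Y → Hom Y Z → Hom X Z
  id_comp : ∀ {X Y} (a : Hom X Y), comp (id X) a = a
  comp_id : ∀ {X Y} (a : Hom X Y), comp a (id Y) = a
  assoc : ∀ {X Y Z T} (a : Hom X Y) (b : Hom Y Z) (c : Hom Z T),
    comp (comp a b) c = comp a (comp b c)
  add_comp : ∀ {X Y Z} (a a' : Hom X Y) (b : Hom Y Z), comp (a + a') b = comp a b + comp a' b
  comp_add : ∀ {X Y Z} (a : Hom X Y) (b b' : Hom Y Z), comp a (b + b') = comp a b + comp a b'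
  /-- the correspondence given by a morphism of schemes -/
  ofHom : ∀ {X Y : Sm S}, (X ⟶ Y) → Hom X Y
  ofHom_id : ∀ X : Sm S, ofHom (𝟙 X) = id X
  ofHom_comp : ∀ {X Y Z : Sm S} (f : X ⟶ Y) (g : Y ⟶ Z), ofHom (f ≫ g) = comp (ofHom f) (ofHom g)

namespace Ringoid

attribute [instance] Ringoid.addCommGroup

/-- The objects of the category of correspondences: a copy of the objects of `Sm S`. -/
structure Cor (R : Ringoid.{w} S) where
  sch : Sm S

variable (R : Ringoid.{w} S)

instance : Category.{w} R.Cor where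
  Hom X Y := R.Hom X.sch Y.sch
  id X := R.id X.sch
  comp a b := R.comp a b
  id_comp := R.id_comp
  comp_id := R.comp_id
  assoc := R.assoc

instance : Preadditive R.Cor where
  homGroup X Y := R.addCommGroup X.sch Y.sch
  add_comp _ _ _ a a' b := R.add_comp a a' b
  comp_add _ _ _ a b b' := R.comp_add a b b'

/-- The functor from schemes to correspondences. -/
def graph : Sm S ⥤ R.Cor where
  obj X := ⟨X⟩
  map f := R.ofHom f
  map_id X := R.ofHom_id X
  map_comp f g := R.ofHom_comp f g

/-- The presheaves `Cor(-, X)` on `Sm S`, as a functor of `X`. -/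
def zTr : Sm S ⥤ (Sm S)ᵒᵖ ⥤ AddCommGrpCat.{w} :=
  R.graph ⋙ preadditiveYoneda ⋙ (Functor.whiskeringLeft _ _ _).obj R.graph.op

/-- The groups `Cor(W^h_p, X) = colim Cor(W', X)`, as a functor of `X`; the colimit is over the
Nisnevich neighbourhoods `W'` of `p` in `W`. -/
def corLocal (W : Sm S) (p : W.left) : Sm S ⥤ AddCommGrpCat.{max w (u + 1)} :=
  R.zTr ⋙ stalkFunctor W p

/-- The group `Cor(W^h_p, X^h_x)` of morphisms of pro-objects, i.e. the limit of
`Cor(W^h_p, X')` over the Nisnevich neighbourhoods `X'` of `x` in `X`. -/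
def corLocalLocal (W : Sm S) (p : W.left) (X : Sm S) (x : X.left) :
    AddCommGrpCat.{max w (u + 1)} :=
  limit (NisNbhd.forget X x ⋙ R.corLocal W p)

/-- Composition with the canonical morphism `X^h_x ⟶ X`. -/
def corLocalLocalMap (W : Sm S) (p : W.left) (X : Sm S) (x : X.left) :
    R.corLocalLocal W p X x →+ (R.corLocal W p).obj X :=
  (limit.π (NisNbhd.forget X x ⋙ R.corLocal W p) (NisNbhd.trivial X x)).hom

open Classical in
/-- Condition (NL): for every Henselian local scheme `W^h_p` of a smooth scheme and every smooth
`X`, the canonical map `⨁_{x ∈ X} Cor(W^h_p, X^h_x) ⟶ Cor(W^h_p, X)` is an isomorphism. -/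
def NL : Prop :=
  ∀ (W : Sm S) (p : W.left) (X : Sm S), Function.Bijective
    (DirectSum.toAddMonoid (R.corLocalLocalMap W p X) :
      (⨁ x : X.left, R.corLocalLocal W p X x) →+ (R.corLocal W p).obj X)

/-! ### Transfers

A presheaf with transfers is an additive functor `R.Corᵒᵖ ⥤ AddCommGrpCat`; its underlying presheaf
on `Sm S` is the composite with `R.graph.op`. -/

/-- A structure of presheaf with transfers on a presheaf `P` of abelian groups on `Sm S`: an
additive functor on correspondences with the same values which restricts to `P` on
`Sm S`. -/
@[ext]
structure TransferStructure (P : (Sm S)ᵒᵖ ⥤ AddCommGrpCat.{v}) where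
  map : ∀ {X Y : Sm S}, R.Hom X Y →+ (P.obj (op Y) →+ P.obj (op X))
  map_ofHom : ∀ {X Y : Sm S} (f : X ⟶ Y), map (R.ofHom f) = (P.map f.op).hom
  map_comp : ∀ {X Y Z : Sm S} (a : R.Hom X Y) (b : R.Hom Y Z),
    map (R.comp a b) = (map a).comp (map b)

variable {R}

/-- The presheaf with transfers defined by a transfer structure. -/
def TransferStructure.toFunctor {P : (Sm S)ᵒᵖ ⥤ AddCommGrpCat.{v}} (t : R.TransferStructure P) :
    R.Corᵒᵖ ⥤ AddCommGrpCat.{v} where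
  obj X := P.obj (op X.unop.sch)
  map a := AddCommGrpCat.ofHom (t.map a.unop)
  map_id X := by
    have h := t.map_ofHom (𝟙 X.unop.sch)
    rw [R.ofHom_id, op_id, P.map_id] at h
    exact AddCommGrpCat.hom_ext h
  map_comp a b := AddCommGrpCat.hom_ext (t.map_comp b.unop a.unop)

instance {P : (Sm S)ᵒᵖ ⥤ AddCommGrpCat.{v}} (t : R.TransferStructure P) :
    t.toFunctor.Additive where
  map_add {_ _ a b} := AddCommGrpCat.hom_ext (t.map.map_add a.unop b.unop)

/-- The underlying presheaf on `Sm S` of the presheaf with transfers is `P`. -/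
lemma TransferStructure.graph_toFunctor {P : (Sm S)ᵒᵖ ⥤ AddCommGrpCat.{v}}
    (t : R.TransferStructure P) : R.graph.op ⋙ t.toFunctor = P :=
  CategoryTheory.Functor.ext (fun _ => rfl) fun _ _ f => 
    (AddCommGrpCat.hom_ext (t.map_ofHom f.unop) :
      (R.graph.op ⋙ t.toFunctor).map f = P.map f).trans
      ((Category.id_comp _).trans (Category.comp_id _)).symm

end Ringoid

end NisTransfers

end

/-! Sheafification enters only as a locally bijective morphism φ from F to a sheaf G. Let s be a
section of G on X and b a correspondence from W to X. Locally s lifts through φ: there are f : Y ⟶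
X, forming a covering sieve, and sections t of F on Y with φ(t) = f^* s. Surjectivity in (NL) shows
that, Nisnevich locally on W, b is a sum of composites f ∘ a with f in this sieve
(`NL.generationSieve_mem`), and then b^* s can only be the sum of the φ(a^* t). This gives
uniqueness, since G is a sheaf (`NL.hom_ext`).

For existence the sum must not depend on the decomposition of b. Injectivity in (NL) yields a
homomorphism Θ from Cor(W^h_p, X) to the stalk of F at p that involves no such decomposition: on the
summand at x it pulls back a lift of s near x, chosen once. Two lifts of s agree near each point, so
Θ also computes the action of every other local lift (`NL.exists_pullGerm`). Hence if a sum of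
composites f ∘ a is 0, the corresponding sum of the a^* t has zero germs, is locally zero, and has
image 0 in G (`NL.eq_of_mem_pullRel`). The local values therefore glue (`NL.exists_glue`), and
additivity and functoriality are checked on covers; composition rests on `exists_lift_pullSection`.
-/

namespace NisTransfers
variable {S : Scheme.{u}}

/-! ### Lifts of `Spec κ(x)` -/

/-- Lifts of Spec κ(x) are used in place of points because they induce maps to fibre products, where
a pair of points over x need not single out one point. -/
lemma exists_residue_section {X Y : Scheme.{u}} (f : Y ⟶ X) {x : X} (y : Y) (h : f y = x)
    (hy : IsIso (f.residueFieldMap y)) :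
    ∃ s : Spec (X.residueField x) ⟶ Y, s ≫ f = X.fromSpecResidueField x ∧
      ∀ t, s t = y := by
  subst h
  refine ⟨Spec.map (inv (f.residueFieldMap y)) ≫ Y.fromSpecResidueField y, ?_, fun t => ?_⟩
  · rw [Category.assoc, ← f.SpecMap_residueFieldMap_fromSpecResidueField y, ← Spec.map_comp_assoc]
    simp
  · rw [Scheme.Hom.comp_apply, Scheme.fromSpecResidueField_apply]

lemma isIso_residueFieldMap_of_section {X Y : Scheme.{u}} (f : Y ⟶ X) {x : X}
    (s : Spec (X.residueField x) ⟶ Y) (hs : s ≫ f = X.fromSpecResidueField x)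
    (t : Spec (X.residueField x)) : IsIso (f.residueFieldMap (s t)) := by
  have h1 : Function.Surjective ((s ≫ f).residueFieldMap t) := by
    rw [hs]; exact surjective_residueFieldMap _ _
  rw [Scheme.residueFieldMap_comp] at h1
  apply isIso_of_surjective_residueFieldMap
  intro b
  obtain ⟨a, ha⟩ := h1 (s.residueFieldMap t b)
  exact ⟨a, (s.residueFieldMap t).hom.injective ha⟩

lemma exists_eq_specMap_comp_fromSpecResidueField {K : Type u} [Field K] {Y : Scheme.{u}}
    (s : Spec (.of K) ⟶ Y) (y : Y) (h : s (IsLocalRing.closedPoint K) = y) :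
    ∃ φ : Y.residueField y ⟶ .of K, s = Spec.map φ ≫ Y.fromSpecResidueField y := by
  subst h
  exact ⟨_, (Scheme.descResidueField_stalkClosedPointTo_fromSpecResidueField K Y s).symm⟩

/-- Each lift factors through Spec κ(y), and κ(x) ≅ κ(y) leaves only one choice for the field
homomorphism. -/
lemma residue_section_unique {X Y : Scheme.{u}} (f : Y ⟶ X) {x : X} (y : Y) (h : f y = x)
    (hy : IsIso (f.residueFieldMap y)) (s s' : Spec (X.residueField x) ⟶ Y)
    (hs : s ≫ f = X.fromSpecResidueField x) (hs' : s' ≫ f = X.fromSpecResidueField x)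
    (hp : ∀ t, s t = y) (hp' : ∀ t, s' t = y) : s = s' := by
  subst h
  obtain ⟨φ, hφ⟩ := exists_eq_specMap_comp_fromSpecResidueField (K := X.residueField (f y)) s y
    (hp _)
  obtain ⟨φ', hφ'⟩ := exists_eq_specMap_comp_fromSpecResidueField (K := X.residueField (f y)) s' y
    (hp' _)
  have h : s ≫ f = s' ≫ f := hs.trans hs'.symm
  rw [hφ, hφ', Category.assoc, Category.assoc,
    ← f.SpecMap_residueFieldMap_fromSpecResidueField y, ← Category.assoc, ← Category.assoc,
    cancel_mono, ← Spec.map_comp, ← Spec.map_comp, Spec.map_inj, cancel_epi] at h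
  rw [hφ, hφ', h]

/-! ### Étale schemes over an object of `Sm S` -/

lemma Sm.isSeparated_left {X Y : Sm S} (f : Y ⟶ X) : IsSeparated f.left := by
  have hw : f.left ≫ X.hom = Y.hom := MorphismProperty.Over.w f
  have hY : Smooth Y.hom ∧ IsSeparated Y.hom ∧ QuasiCompact Y.hom := Y.prop
  have : IsSeparated (f.left ≫ X.hom) := by rw [hw]; exact hY.2.1
  exact .of_comp _ X.hom

lemma Sm.quasiCompact_left {X Y : Sm S} (f : Y ⟶ X) : QuasiCompact f.left := by
  have hw : f.left ≫ X.hom = Y.hom := MorphismProperty.Over.w f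
  have hX : Smooth X.hom ∧ IsSeparated X.hom ∧ QuasiCompact X.hom := X.prop
  have hY : Smooth Y.hom ∧ IsSeparated Y.hom ∧ QuasiCompact Y.hom := Y.prop
  have : QuasiCompact (f.left ≫ X.hom) := by rw [hw]; exact hY.2.2
  have := hX.2.1
  exact .of_comp _ X.hom

/-- A separated quasi-compact étale scheme over an object of `Sm S`, as an object of `Sm S`. -/
def etaleOver (X : Sm S) {U : Scheme.{u}} (q : U ⟶ X.left) (h₁ : Etale q) (h₂ : IsSeparated q)
    (h₃ : QuasiCompact q) : Sm S :=
  MorphismProperty.Over.mk ⊤ (q ≫ X.hom) <| by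
    have hX : Smooth X.hom ∧ IsSeparated X.hom ∧ QuasiCompact X.hom := X.prop
    have := hX.1
    have := hX.2.1
    have := hX.2.2
    exact ⟨inferInstance, inferInstance, inferInstance⟩

/-- The structure morphism of `etaleOver`. -/
def etaleOverMap (X : Sm S) {U : Scheme.{u}} (q : U ⟶ X.left) (h₁ : Etale q) (h₂ : IsSeparated q)
    (h₃ : QuasiCompact q) : etaleOver X q h₁ h₂ h₃ ⟶ X :=
  MorphismProperty.Over.homMk q rfl trivial

/-! ### Nisnevich neighbourhoods as étale schemes with a lift of Spec κ(x) -/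

namespace NisNbhd

variable {X : Sm S} {x : X.left}

/-- The canonical lift of `Spec κ(x)` to a Nisnevich neighbourhood of `x`. -/
noncomputable def sec (A : NisNbhd X x) : Spec (X.left.residueField x) ⟶ A.obj.left :=
  (exists_residue_section A.map.left A.pt A.map_pt A.isNisAt.residue).choose

lemma sec_map (A : NisNbhd X x) : A.sec ≫ A.map.left = X.left.fromSpecResidueField x :=
  (exists_residue_section A.map.left A.pt A.map_pt A.isNisAt.residue).choose_spec.1

lemma sec_apply (A : NisNbhd X x) (t) : A.sec t = A.pt :=
  (exists_residue_section A.map.left A.pt A.map_pt A.isNisAt.residue).choose_spec.2 t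

lemma eq_sec (A : NisNbhd X x) (s : Spec (X.left.residueField x) ⟶ A.obj.left)
    (hs : s ≫ A.map.left = X.left.fromSpecResidueField x) (hp : ∀ t, s t = A.pt) : s = A.sec :=
  residue_section_unique A.map.left A.pt A.map_pt A.isNisAt.residue _ _ hs A.sec_map hp A.sec_apply

lemma Hom.sec_comp {A B : NisNbhd X x} (f : A ⟶ B) : A.sec ≫ f.hom.left = B.sec := by
  apply eq_sec
  · have : f.hom.left ≫ B.map.left = A.map.left := congrArg (fun g => g.left) f.w
    rw [Category.assoc, this, sec_map]
  · intro t
    rw [Scheme.Hom.comp_apply, sec_apply]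
    exact f.hom_pt

/-- The point of the spectrum of a residue field. -/
noncomputable def residuePt (x : X.left) : Spec (X.left.residueField x) :=
  IsLocalRing.closedPoint (X.left.residueField x)

/-- The Nisnevich neighbourhood of `x` given by a separated quasi-compact étale scheme over `X`
and a lift of `Spec κ(x)`. -/
noncomputable def ofSection (X : Sm S) (x : X.left) {U : Scheme.{u}} (q : U ⟶ X.left)
    (h₁ : Etale q) (h₂ : IsSeparated q) (h₃ : QuasiCompact q)
    (s : Spec (X.left.residueField x) ⟶ U) (hs : s ≫ q = X.left.fromSpecResidueField x) :
    NisNbhd X x where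
  obj := etaleOver X q h₁ h₂ h₃
  map := etaleOverMap X q h₁ h₂ h₃
  pt := s (residuePt x)
  map_pt := by
    change q (s (residuePt x)) = x
    rw [← Scheme.Hom.comp_apply, hs, Scheme.fromSpecResidueField_apply]
  isNisAt := ⟨h₁, isIso_residueFieldMap_of_section q s hs _⟩

lemma isEtale (A : NisNbhd X x) : Etale A.map.left := A.isNisAt.etale

/-- Nisnevich neighbourhoods of a distinguished point of a Nisnevich neighbourhood. -/
def comp (A : NisNbhd X x) (B : NisNbhd A.obj A.pt) : NisNbhd X x where
  obj := B.obj
  map := B.map ≫ A.map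
  pt := B.pt
  map_pt := by
    change (B.map.left ≫ A.map.left) B.pt = x
    rw [Scheme.Hom.comp_apply, B.map_pt, A.map_pt]
  isNisAt := by
    have h := A.isNisAt.residue
    have h₁ := A.isEtale
    have h₂ := B.isEtale
    refine ⟨inferInstanceAs (Etale (B.map.left ≫ A.map.left)), ?_⟩
    change IsIso ((B.map.left ≫ A.map.left).residueFieldMap B.pt)
    rw [Scheme.residueFieldMap_comp]
    rw [← B.map_pt] at h
    exact IsIso.comp_isIso' h B.isNisAt.residue

/-- The morphism from an iterated Nisnevich neighbourhood. -/
def compHom (A : NisNbhd X x) (B : NisNbhd A.obj A.pt) : A.comp B ⟶ A :=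
  ⟨B.map, rfl, B.map_pt⟩

/-! ### Base change of Nisnevich neighbourhoods -/

section Pullback

variable {Y : Sm S} (g : Y ⟶ X) (y : Y.left) (h : g.left y = x)

include h in
lemma exists_fromSpecResidueField_comp : ∃ k : Spec (Y.left.residueField y) ⟶
    Spec (X.left.residueField x), k ≫ X.left.fromSpecResidueField x =
      Y.left.fromSpecResidueField y ≫ g.left := by
  subst h
  exact ⟨_, g.left.SpecMap_residueFieldMap_fromSpecResidueField y⟩

/-- The lift of `Spec κ(y)` to the pullback of a neighbourhood of `x = g y`. -/
noncomputable def pullbackSec (A : NisNbhd X x) :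
    Spec (Y.left.residueField y) ⟶ pullback g.left A.map.left :=
  pullback.lift (Y.left.fromSpecResidueField y)
    ((exists_fromSpecResidueField_comp g y h).choose ≫ A.sec) <| by
      rw [Category.assoc, sec_map, (exists_fromSpecResidueField_comp g y h).choose_spec]

lemma pullbackSec_fst (A : NisNbhd X x) :
    pullbackSec g y h A ≫ pullback.fst g.left A.map.left = Y.left.fromSpecResidueField y :=
  pullback.lift_fst _ _ _

lemma pullbackSec_snd (A : NisNbhd X x) :
    pullbackSec g y h A ≫ pullback.snd g.left A.map.left =
      (exists_fromSpecResidueField_comp g y h).choose ≫ A.sec :=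
  pullback.lift_snd _ _ _

/-- The pullback of a Nisnevich neighbourhood. -/
noncomputable def pb (A : NisNbhd X x) : NisNbhd Y y :=
  have := A.isEtale
  have := Sm.isSeparated_left A.map
  have := Sm.quasiCompact_left A.map
  ofSection Y y (pullback.fst g.left A.map.left) inferInstance inferInstance inferInstance
    (pullbackSec g y h A) (pullbackSec_fst g y h A)

/-- The second projection from the pullback of a Nisnevich neighbourhood. -/
noncomputable def pbSnd (A : NisNbhd X x) : (pb g y h A).obj ⟶ A.obj :=
  MorphismProperty.Over.homMk (pullback.snd g.left A.map.left) (by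
    change pullback.snd g.left A.map.left ≫ A.obj.hom = pullback.fst g.left A.map.left ≫ Y.hom
    have h₁ : A.map.left ≫ X.hom = A.obj.hom := MorphismProperty.Over.w A.map
    have h₂ : g.left ≫ X.hom = Y.hom := MorphismProperty.Over.w g
    rw [← h₁, ← h₂, pullback.condition_assoc]) True.intro

lemma pb_condition (A : NisNbhd X x) :
    (pb g y h A).map ≫ g = pbSnd g y h A ≫ A.map := by
  ext
  exact pullback.condition (f := g.left) (g := A.map.left)

lemma pbSnd_pt (A : NisNbhd X x) : (pbSnd g y h A).left (pb g y h A).pt = A.pt := by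
  change (pullback.snd g.left A.map.left) (pullbackSec g y h A (residuePt y)) = A.pt
  rw [← Scheme.Hom.comp_apply, pullbackSec_snd, Scheme.Hom.comp_apply, sec_apply]

/-- The morphism of schemes underlying `pbMap`. -/
noncomputable def pbMapLeft {A B : NisNbhd X x} (f : A ⟶ B) :
    pullback g.left A.map.left ⟶ pullback g.left B.map.left :=
  pullback.lift (pullback.fst _ _) (pullback.snd _ _ ≫ f.hom.left) <| by
    have : f.hom.left ≫ B.map.left = A.map.left := congrArg (fun g => g.left) f.w
    rw [Category.assoc, this, pullback.condition]

lemma pbMapLeft_fst {A B : NisNbhd X x} (f : A ⟶ B) :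
    pbMapLeft g f ≫ pullback.fst g.left B.map.left = pullback.fst g.left A.map.left :=
  pullback.lift_fst _ _ _

lemma pbMapLeft_snd {A B : NisNbhd X x} (f : A ⟶ B) :
    pbMapLeft g f ≫ pullback.snd g.left B.map.left =
      pullback.snd g.left A.map.left ≫ f.hom.left :=
  pullback.lift_snd _ _ _

lemma pullbackSec_comp_pbMapLeft {A B : NisNbhd X x} (f : A ⟶ B) :
    pullbackSec g y h A ≫ pbMapLeft g f = pullbackSec g y h B := by
  apply pullback.hom_ext
  · rw [Category.assoc, pbMapLeft_fst, pullbackSec_fst, pullbackSec_fst]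
  · rw [Category.assoc, pbMapLeft_snd, ← Category.assoc, pullbackSec_snd, pullbackSec_snd,
      Category.assoc, Hom.sec_comp]

/-- The functoriality of the pullback of Nisnevich neighbourhoods. -/
noncomputable def pbMap {A B : NisNbhd X x} (f : A ⟶ B) : pb g y h A ⟶ pb g y h B where
  hom := MorphismProperty.Over.homMk (pbMapLeft g f) (by
      change pbMapLeft g f ≫ pullback.fst _ _ ≫ Y.hom = pullback.fst _ _ ≫ Y.hom
      rw [← Category.assoc, pbMapLeft_fst]) True.intro
  w := by
    ext
    exact pbMapLeft_fst g f
  hom_pt := by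
    change pbMapLeft g f (pullbackSec g y h A (residuePt y)) = pullbackSec g y h B (residuePt y)
    rw [← Scheme.Hom.comp_apply, pullbackSec_comp_pbMapLeft]

lemma pbMap_snd {A B : NisNbhd X x} (f : A ⟶ B) :
    (pbMap g y h f).hom ≫ pbSnd g y h B = pbSnd g y h A ≫ f.hom := by
  ext
  exact pbMapLeft_snd g f

end Pullback

/-! ### Nisnevich neighbourhoods are cofiltered -/

/-- A common refinement of two Nisnevich neighbourhoods. -/
noncomputable def inf (A B : NisNbhd X x) : NisNbhd X x := A.comp (pb A.map A.pt A.map_pt B)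

/-- The first projection of a common refinement. -/
noncomputable def infLeft (A B : NisNbhd X x) : A.inf B ⟶ A := A.compHom _

/-- The second projection of a common refinement. -/
noncomputable def infRight (A B : NisNbhd X x) : A.inf B ⟶ B :=
  ⟨pbSnd A.map A.pt A.map_pt B, (pb_condition A.map A.pt A.map_pt B).symm,
    pbSnd_pt A.map A.pt A.map_pt B⟩

/-- The diagonal of the étale morphism `B.map` is an open immersion, so the locus where f and g
agree is étale over A. It contains the distinguished point because f and g both carry the lift of
Spec κ(x) for A to the one for B. Separatedness of `B.map` makes the locus quasi-compact over A. -/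
lemma exists_equalizer {A B : NisNbhd X x} (f g : A ⟶ B) :
    ∃ (E : NisNbhd X x) (e : E ⟶ A), e ≫ f = e ≫ g := by
  have hf : f.hom.left ≫ B.map.left = A.map.left := congrArg (fun g => g.left) f.w
  have hg : g.hom.left ≫ B.map.left = A.map.left := congrArg (fun g => g.left) g.w
  have := B.isEtale
  have := Sm.isSeparated_left B.map
  let l : A.obj.left ⟶ pullback B.map.left B.map.left :=
    pullback.lift f.hom.left g.hom.left (hf.trans hg.symm)
  let q : pullback l (pullback.diagonal B.map.left) ⟶ A.obj.left :=
    pullback.fst l (pullback.diagonal B.map.left)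
  have hq : q ≫ f.hom.left = q ≫ g.hom.left := by
    have h := pullback.condition (f := l) (g := pullback.diagonal B.map.left)
    have h₁ := congrArg (· ≫ pullback.fst _ _) h
    have h₂ := congrArg (· ≫ pullback.snd _ _) h
    simp only [Category.assoc, pullback.diagonal_fst, pullback.diagonal_snd, l,
      pullback.lift_fst, pullback.lift_snd] at h₁ h₂
    exact h₁.trans h₂.symm
  have hs : A.sec ≫ l = B.sec ≫ pullback.diagonal B.map.left := by
    apply pullback.hom_ext
    · rw [Category.assoc, Category.assoc, pullback.lift_fst, pullback.diagonal_fst,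
        Hom.sec_comp, Category.comp_id]
    · rw [Category.assoc, Category.assoc, pullback.lift_snd, pullback.diagonal_snd,
        Hom.sec_comp, Category.comp_id]
  have := A.isEtale
  have := Sm.isSeparated_left A.map
  have := Sm.quasiCompact_left A.map
  let E : NisNbhd X x := ofSection X x (q ≫ A.map.left) (by dsimp only [q]; infer_instance)
    (by dsimp only [q]; infer_instance) (by dsimp only [q]; infer_instance)
    (pullback.lift _ _ hs) (by dsimp only [q]; rw [pullback.lift_fst_assoc, sec_map])
  have hE : q ≫ A.obj.hom = (q ≫ A.map.left) ≫ X.hom := by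
    have h : A.map.left ≫ X.hom = A.obj.hom := MorphismProperty.Over.w A.map
    rw [Category.assoc, h]
  let e : E ⟶ A := ⟨MorphismProperty.Over.homMk q hE True.intro, by ext; rfl, by
    change q (pullback.lift _ _ hs (residuePt x)) = A.pt
    rw [← Scheme.Hom.comp_apply, pullback.lift_fst, sec_apply]⟩
  exact ⟨E, e, Hom.ext (by ext; exact hq)⟩

instance : IsCofiltered (NisNbhd X x) where
  cone_objs A B := ⟨A.inf B, A.infLeft B, A.infRight B, True.intro⟩
  cone_maps _ _ f g := exists_equalizer f g
  nonempty := ⟨NisNbhd.trivial X x⟩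

end NisNbhd

/-! ### Germs -/

section Germs

variable {X : Sm S} {x : X.left}

/-- The system of sections of a presheaf on the Nisnevich neighbourhoods of a point. -/
noncomputable abbrev stalkDiagram (x : X.left) (P : (Sm S)ᵒᵖ ⥤ AddCommGrpCat.{w}) :
    (NisNbhd X x)ᵒᵖ ⥤ AddCommGrpCat.{max w (u + 1)} :=
  ((NisNbhd.forget X x).op ⋙ P) ⋙ AddCommGrpCat.uliftFunctor.{u + 1, w}

/-- The germ of a section of a presheaf on a Nisnevich neighbourhood. -/
noncomputable def germ (P : (Sm S)ᵒᵖ ⥤ AddCommGrpCat.{w}) (A : NisNbhd X x) :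
    P.obj (op A.obj) →+ (stalkFunctor X x).obj P :=
  (colimit.ι (stalkDiagram x P) (op A)).hom.comp
    (AddEquiv.ulift.{w, u + 1} (α := P.obj (op A.obj))).symm.toAddMonoidHom

lemma germ_res (P : (Sm S)ᵒᵖ ⥤ AddCommGrpCat.{w}) {A B : NisNbhd X x} (f : B ⟶ A)
    (a : P.obj (op A.obj)) : germ P B (P.map f.hom.op a) = germ P A a :=
  congrArg (fun k => k.hom (ULift.up a)) (colimit.w (stalkDiagram x P) f.op)

/-- Neighbourhoods form a category with objects in universe u + 1 and morphisms in u; this is the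
size needed to represent elements of stalks by sections. -/
instance preservesFilteredColimitsOfSize_forget :
    PreservesFilteredColimitsOfSize.{u, u + 1} (forget AddCommGrpCat.{max w (u + 1)}) := by
  have : PreservesFilteredColimitsOfSize.{max u (max w (u + 1)), max (u + 1) (max w (u + 1))}
    (forget AddCommGrpCat.{max w (u + 1)}) := inferInstanceAs
      (PreservesFilteredColimits (forget AddCommGrpCat.{max w (u + 1)}))
  exact preservesFilteredColimitsOfSize_shrink.{u + 1, max w (u + 1), u, max w (u + 1)}
    (forget AddCommGrpCat.{max w (u + 1)})

lemma exists_germ_eq (P : (Sm S)ᵒᵖ ⥤ AddCommGrpCat.{w}) (z : (stalkFunctor X x).obj P) :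
    ∃ (A : NisNbhd X x) (a : P.obj (op A.obj)), germ P A a = z := by
  obtain ⟨A, a, h⟩ := Concrete.colimit_exists_rep (stalkDiagram x P) z
  exact ⟨A.unop, a.down, h⟩

lemma exists_res_eq_of_germ_eq (P : (Sm S)ᵒᵖ ⥤ AddCommGrpCat.{w}) {A B : NisNbhd X x}
    {a : P.obj (op A.obj)} {b : P.obj (op B.obj)} (h : germ P A a = germ P B b) :
    ∃ (C : NisNbhd X x) (f : C ⟶ A) (g : C ⟶ B), P.map f.hom.op a = P.map g.hom.op b := by
  obtain ⟨C, f, g, hC⟩ := Concrete.colimit_exists_of_rep_eq (stalkDiagram x P)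
    (i := op A) (j := op B) (ULift.up a) (ULift.up b) h
  exact ⟨C.unop, f.unop, g.unop, congrArg ULift.down hC⟩

/-- The germ at a point of a section of a presheaf. -/
noncomputable def germAt (P : (Sm S)ᵒᵖ ⥤ AddCommGrpCat.{w}) (x : X.left) :
    P.obj (op X) →+ (stalkFunctor X x).obj P :=
  germ P (NisNbhd.trivial X x)

lemma exists_res_eq_zero_of_germAt_eq_zero (P : (Sm S)ᵒᵖ ⥤ AddCommGrpCat.{w})
    {a : P.obj (op X)} (h : germAt P x a = 0) :
    ∃ A : NisNbhd X x, P.map A.map.op a = 0 := by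
  obtain ⟨A, f, g, hA⟩ := exists_res_eq_of_germ_eq P (h.trans (map_zero (germAt P x)).symm)
  -- The only morphism from A to the trivial neighbourhood is the structure morphism of A.
  have hf : f.hom = A.map := (Category.comp_id _).symm.trans f.w
  exact ⟨A, hf ▸ hA.trans (map_zero _)⟩

lemma stalkFunctor_map_germ {P Q : (Sm S)ᵒᵖ ⥤ AddCommGrpCat.{w}} (φ : P ⟶ Q) (A : NisNbhd X x)
    (a : P.obj (op A.obj)) :
    (stalkFunctor X x).map φ (germ P A a) = germ Q A (φ.app _ a) := by
  have h := ι_colimMap (F := stalkDiagram x Q) (G := stalkDiagram x P)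
    (Functor.whiskerRight (Functor.whiskerLeft _ φ) _) (op A)
  exact congrArg (fun k : (stalkDiagram x P).obj (op A) ⟶ colimit (stalkDiagram x Q) =>
    k.hom (ULift.up a)) h

section Desc

variable {P : (Sm S)ᵒᵖ ⥤ AddCommGrpCat.{w}} {M : Type*} [AddCommGroup M]
  (φ : ∀ A : NisNbhd X x, P.obj (op A.obj) →+ M)
  (hφ : ∀ (A B : NisNbhd X x) (f : B ⟶ A) (a : P.obj (op A.obj)), φ B (P.map f.hom.op a) = φ A a)

include hφ in
lemma eq_of_germ_eq {A B : NisNbhd X x} {a : P.obj (op A.obj)} {b : P.obj (op B.obj)}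
    (h : germ P A a = germ P B b) : φ A a = φ B b := by
  obtain ⟨C, f, g, hC⟩ := exists_res_eq_of_germ_eq P h
  rw [← hφ _ _ f, hC, hφ _ _ g]

/-- The homomorphism from the stalk given by a compatible family of homomorphisms; its target
can be in any universe. -/
noncomputable def stalkDesc : (stalkFunctor X x).obj P →+ M :=
  AddMonoidHom.mk' (fun z => φ _ (exists_germ_eq P z).choose_spec.choose) <| by
    have key : ∀ (z) (A : NisNbhd X x) (a : P.obj (op A.obj)), germ P A a = z →
        φ _ (exists_germ_eq P z).choose_spec.choose = φ A a := fun z A a h =>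
      eq_of_germ_eq φ hφ ((exists_germ_eq P z).choose_spec.choose_spec.trans h.symm)
    intro z z'
    obtain ⟨A, a, rfl⟩ := exists_germ_eq P z
    obtain ⟨B, b, rfl⟩ := exists_germ_eq P z'
    rw [key _ A a rfl, key _ B b rfl, ← hφ _ _ (A.infLeft B) a,
      ← hφ _ _ (A.infRight B) b, ← map_add]
    apply key
    rw [map_add, germ_res, germ_res]

lemma stalkDesc_germ (A : NisNbhd X x) (a : P.obj (op A.obj)) :
    stalkDesc φ hφ (germ P A a) = φ A a :=
  eq_of_germ_eq φ hφ (exists_germ_eq P _).choose_spec.choose_spec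

end Desc

end Germs

/-! ### Nisnevich covers and neighbourhoods -/

lemma exists_nbhd_of_mem {X : Sm S} {R : Sieve X} (hR : R ∈ nisnevichTopology S X) (x : X.left) :
    ∃ A : NisNbhd X x, R A.map := by
  obtain ⟨U, f, p, hf, hp, h⟩ := hR x
  exact ⟨⟨U, f, p, hp, h⟩, hf⟩

lemma mem_of_exists_nbhd {X : Sm S} {R : Sieve X} (h : ∀ x : X.left, ∃ A : NisNbhd X x, R A.map) :
    R ∈ nisnevichTopology S X := fun x => by
  obtain ⟨A, hA⟩ := h x
  exact ⟨A.obj, A.map, A.pt, hA, A.map_pt, A.isNisAt⟩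

/-- This makes the sheafification morphism locally injective and locally surjective; it is
transported from a small model of `Sm S`. -/
instance : (nisnevichTopology S).WEqualsLocallyBijective AddCommGrpCat.{max v (u + 1)} := by
  have : GrothendieckTopology.WEqualsLocallyBijective
      ((equivSmallModel.{max v (u + 1)} (Sm S)).inverse.inducedTopology (nisnevichTopology S))
      AddCommGrpCat.{max v (u + 1)} := inferInstance
  exact GrothendieckTopology.WEqualsLocallyBijective.ofEssentiallySmall.{u, max v (u + 1), u + 1,
    (max v (u + 1)) + 1, max v (u + 1)}
    (nisnevichTopology S)

namespace Ringoid
variable (R : Ringoid.{w} S)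

/-! ### Germs of correspondences -/

section CorGerm

variable {W X Y : Sm S} {p : W.left}

/-- The germ at `p` of a correspondence defined on a Nisnevich neighbourhood of `p`. -/
noncomputable def corGerm (A : NisNbhd W p) : R.Hom A.obj X →+ (R.corLocal W p).obj X :=
  germ (R.zTr.obj X) A

lemma corGerm_res {A B : NisNbhd W p} (f : B ⟶ A) (a : R.Hom A.obj X) :
    R.corGerm B (R.comp (R.ofHom f.hom) a) = R.corGerm A a :=
  germ_res (R.zTr.obj X) f a

lemma corLocal_map_corGerm (f : X ⟶ Y) (A : NisNbhd W p) (a : R.Hom A.obj X) :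
    (R.corLocal W p).map f (R.corGerm A a) = R.corGerm A (R.comp a (R.ofHom f)) :=
  stalkFunctor_map_germ (R.zTr.map f) A a

/-- The germ of a correspondence at a point. -/
noncomputable def corGermAt (p : W.left) : R.Hom W X →+ (R.corLocal W p).obj X :=
  R.corGerm (NisNbhd.trivial W p)

lemma corLocal_map_corGermAt (f : X ⟶ Y) (a : R.Hom W X) :
    (R.corLocal W p).map f (R.corGermAt p a) = R.corGermAt p (R.comp a (R.ofHom f)) :=
  R.corLocal_map_corGerm f (NisNbhd.trivial W p) a

lemma exists_corGerm_eq (z : (R.corLocal W p).obj X) :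
    ∃ (A : NisNbhd W p) (a : R.Hom A.obj X), R.corGerm A a = z :=
  exists_germ_eq (R.zTr.obj X) z

lemma exists_res_eq_of_corGerm_eq {A B : NisNbhd W p} {a : R.Hom A.obj X} {b : R.Hom B.obj X}
    (h : R.corGerm A a = R.corGerm B b) : ∃ (C : NisNbhd W p) (f : C ⟶ A) (g : C ⟶ B),
      R.comp (R.ofHom f.hom) a = R.comp (R.ofHom g.hom) b :=
  exists_res_eq_of_germ_eq (R.zTr.obj X) h

end CorGerm

/-! ### Correspondences between Henselian local schemes -/

section CorLocalLocal

variable {W X Y : Sm S} {p : W.left} {x : X.left}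

/-- The components of a correspondence of Henselian local schemes. -/
noncomputable def corLocalLocalProj (A : NisNbhd X x) :
    R.corLocalLocal W p X x →+ (R.corLocal W p).obj A.obj :=
  (limit.π (NisNbhd.forget X x ⋙ R.corLocal W p) A).hom

lemma corLocal_map_corLocalLocalProj {A B : NisNbhd X x} (f : A ⟶ B)
    (c : R.corLocalLocal W p X x) :
    (R.corLocal W p).map f.hom (R.corLocalLocalProj A c) = R.corLocalLocalProj B c :=
  congrArg (fun k => k.hom c) (limit.w (NisNbhd.forget X x ⋙ R.corLocal W p) f)

lemma corLocal_map_corLocalLocalProj_eq_corLocalLocalMap (A : NisNbhd X x)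
    (c : R.corLocalLocal W p X x) :
    (R.corLocal W p).map A.map (R.corLocalLocalProj A c) = R.corLocalLocalMap W p X x c :=
  R.corLocal_map_corLocalLocalProj
    (⟨A.map, Category.comp_id _, A.map_pt⟩ : A ⟶ NisNbhd.trivial X x) c

/-- The cone defining `corLocalLocalPush`. -/
noncomputable def corLocalLocalPushCone (W : Sm S) (p : W.left) (f : Y ⟶ X) (y : Y.left)
    (h : f.left y = x) : Cone (NisNbhd.forget X x ⋙ R.corLocal W p) where
  pt := R.corLocalLocal W p Y y
  π :=
    { app := fun A => limit.π (NisNbhd.forget Y y ⋙ R.corLocal W p) (NisNbhd.pb f y h A) ≫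
        (R.corLocal W p).map (NisNbhd.pbSnd f y h A)
      naturality := fun A B g => by
        refine AddCommGrpCat.hom_ext (AddMonoidHom.ext fun c => ?_)
        change (R.corLocal W p).map (NisNbhd.pbSnd f y h B)
            (R.corLocalLocalProj (NisNbhd.pb f y h B) c) =
          (R.corLocal W p).map g.hom ((R.corLocal W p).map (NisNbhd.pbSnd f y h A)
            (R.corLocalLocalProj (NisNbhd.pb f y h A) c))
        rw [← corLocal_map_corLocalLocalProj R (NisNbhd.pbMap f y h g),
          ← ConcreteCategory.comp_apply, ← ConcreteCategory.comp_apply,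
          ← Functor.map_comp, ← Functor.map_comp, NisNbhd.pbMap_snd] }

/-- The action of a pointed morphism on correspondences of Henselian local schemes. -/
noncomputable def corLocalLocalPush (W : Sm S) (p : W.left) (f : Y ⟶ X) (y : Y.left)
    (h : f.left y = x) : R.corLocalLocal W p Y y ⟶ R.corLocalLocal W p X x :=
  limit.lift _ (R.corLocalLocalPushCone W p f y h)

lemma corLocalLocalProj_push (f : Y ⟶ X) (y : Y.left) (h : f.left y = x) (A : NisNbhd X x)
    (c : R.corLocalLocal W p Y y) :
    R.corLocalLocalProj A (R.corLocalLocalPush W p f y h c) =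
      (R.corLocal W p).map (NisNbhd.pbSnd f y h A)
        (R.corLocalLocalProj (NisNbhd.pb f y h A) c) :=
  congrArg (fun k : R.corLocalLocal W p Y y ⟶ (R.corLocal W p).obj A.obj => k.hom c)
    (limit.lift_π (R.corLocalLocalPushCone W p f y h) A)

/-- Thus composition with f respects the decompositions of (NL), sending the summand at y to the
summand at f(y). -/
lemma corLocalLocalMap_push (f : Y ⟶ X) (y : Y.left) (h : f.left y = x)
    (c : R.corLocalLocal W p Y y) :
    R.corLocalLocalMap W p X x (R.corLocalLocalPush W p f y h c) =
      (R.corLocal W p).map f (R.corLocalLocalMap W p Y y c) := by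
  have h₁ := R.corLocalLocalProj_push f y h (NisNbhd.trivial X x) c
  rw [← R.corLocal_map_corLocalLocalProj_eq_corLocalLocalMap
    (NisNbhd.pb f y h (NisNbhd.trivial X x)) c, ← ConcreteCategory.comp_apply,
    ← Functor.map_comp, NisNbhd.pb_condition]
  exact h₁.trans (congrArg (fun k => (R.corLocal W p).map k (R.corLocalLocalProj _ c))
    (Category.comp_id _).symm)

end CorLocalLocal

/-! ### Local generation of correspondences by a covering sieve -/

section Generation

variable {R} {V W X : Sm S}

variable (R) in
/-- The group of correspondences generated by those that factor through a given sieve. -/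
def sieveCor (Q : Sieve X) (V : Sm S) : AddSubgroup (R.Hom V X) :=
  AddSubgroup.closure {b | ∃ (Y : Sm S) (f : Y ⟶ X) (a : R.Hom V Y), Q f ∧ R.comp a (R.ofHom f) = b}

lemma comp_ofHom_mem_sieveCor {Q : Sieve X} {Y : Sm S} {f : Y ⟶ X} (hf : Q f) (a : R.Hom V Y) :
    R.comp a (R.ofHom f) ∈ R.sieveCor Q V :=
  AddSubgroup.subset_closure ⟨Y, f, a, hf, rfl⟩

variable (R) in
/-- Composition of correspondences as a homomorphism in the second variable. -/
def compHom (a : R.Hom V W) (X : Sm S) : R.Hom W X →+ R.Hom V X :=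
  AddMonoidHom.mk' (R.comp a) (R.comp_add a)

lemma comp_mem_sieveCor {Q : Sieve X} {b : R.Hom W X} (hb : b ∈ R.sieveCor Q W) (a : R.Hom V W) :
    R.comp a b ∈ R.sieveCor Q V := by
  have : R.sieveCor Q W ≤ (R.sieveCor Q V).comap (R.compHom a X) := by
    rw [sieveCor, AddSubgroup.closure_le]
    rintro _ ⟨Y, f, c, hf, rfl⟩
    change R.comp a (R.comp c (R.ofHom f)) ∈ R.sieveCor Q V
    rw [← R.assoc]
    exact comp_ofHom_mem_sieveCor hf _
  exact this hb

/-- Only surjectivity in (NL) is needed: a germ in the summand at x factors through every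
neighbourhood of x, in particular through one belonging to Q. Finite sums are formed on a common
refinement. -/
lemma NL.exists_corGerm_mem_sieveCor (hR : R.NL) {Q : Sieve X}
    (hQ : Q ∈ nisnevichTopology S X) {p : W.left} (z : (R.corLocal W p).obj X) :
    ∃ (A : NisNbhd W p), ∃ b ∈ R.sieveCor Q A.obj, R.corGerm A b = z := by
  classical
  obtain ⟨d, rfl⟩ := (hR W p X).2 z
  induction d using DirectSum.induction_on with
  | zero => exact ⟨NisNbhd.trivial W p, 0, zero_mem _, by rw [map_zero, map_zero]⟩
  | of x c =>
    obtain ⟨B, hB⟩ := exists_nbhd_of_mem hQ x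
    obtain ⟨A, a, ha⟩ := R.exists_corGerm_eq (R.corLocalLocalProj B c)
    refine ⟨A, R.comp a (R.ofHom B.map), comp_ofHom_mem_sieveCor hB a, ?_⟩
    rw [← corLocal_map_corGerm, ha, corLocal_map_corLocalLocalProj_eq_corLocalLocalMap]
    exact (DirectSum.toAddMonoid_of _ _ _).symm
  | add d d' h h' =>
    obtain ⟨A, b, hb, e⟩ := h
    obtain ⟨A', b', hb', e'⟩ := h'
    refine ⟨A.inf A', _, add_mem (comp_mem_sieveCor hb (R.ofHom (A.infLeft A').hom))
      (comp_mem_sieveCor hb' (R.ofHom (A.infRight A').hom)), ?_⟩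
    rw [map_add, map_add, corGerm_res, corGerm_res, e, e']

variable (R) in
/-- The sieve of morphisms along which a correspondence is generated by a given sieve. -/
def generationSieve (Q : Sieve X) (b : R.Hom W X) : Sieve W where
  arrows V g := R.comp (R.ofHom g) b ∈ R.sieveCor Q V
  downward_closed {V V'} g hg k := by
    rw [R.ofHom_comp, R.assoc]
    exact comp_mem_sieveCor hg _

lemma NL.generationSieve_mem (hR : R.NL) {Q : Sieve X} (hQ : Q ∈ nisnevichTopology S X)
    (b : R.Hom W X) : R.generationSieve Q b ∈ nisnevichTopology S W := by
  refine mem_of_exists_nbhd fun p => ?_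
  obtain ⟨A, b', hb', e⟩ :=
    hR.exists_corGerm_mem_sieveCor hQ (R.corGerm (NisNbhd.trivial W p) b)
  obtain ⟨C, f, g, h⟩ := R.exists_res_eq_of_corGerm_eq e.symm
  refine ⟨C, ?_⟩
  change R.comp (R.ofHom C.map) b ∈ R.sieveCor Q C.obj
  have hf : f.hom = C.map := (Category.comp_id _).symm.trans f.w
  rw [← hf]
  exact h ▸ comp_mem_sieveCor hb' _

end Generation

/-! ### The action of correspondences on germs -/

section Action

variable {R} (F : R.Corᵒᵖ ⥤ AddCommGrpCat.{v}) [F.Additive]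

/-- The pullback of sections of a presheaf with transfers by correspondences. -/
def pull {X Y : Sm S} : R.Hom X Y →+
    ((R.graph.op ⋙ F).obj (op Y) →+ (R.graph.op ⋙ F).obj (op X)) :=
  AddMonoidHom.mk' (fun a => (F.map (Quiver.Hom.op (X := R.graph.obj X) (Y := R.graph.obj Y) a)).hom)
    fun _ _ => congrArg (·.hom) (F.map_add (X := op (R.graph.obj Y)) (Y := op (R.graph.obj X)))

lemma pull_comp {X Y Z : Sm S} (a : R.Hom X Y) (b : R.Hom Y Z)
    (t : (R.graph.op ⋙ F).obj (op Z)) :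
    pull F (R.comp a b) t = pull F a (pull F b t) :=
  congrArg (fun k => k.hom t) (F.map_comp
    (Quiver.Hom.op (X := R.graph.obj Y) (Y := R.graph.obj Z) b)
    (Quiver.Hom.op (X := R.graph.obj X) (Y := R.graph.obj Y) a))

lemma pull_ofHom {X Y : Sm S} (f : X ⟶ Y) (t : (R.graph.op ⋙ F).obj (op Y)) :
    pull F (R.ofHom f) t = (R.graph.op ⋙ F).map f.op t := rfl

lemma pull_id {X : Sm S} (t : (R.graph.op ⋙ F).obj (op X)) : pull F (R.id X) t = t :=
  ConcreteCategory.congr_hom (F.map_id (op (R.graph.obj X))) t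

variable {W X Y : Sm S} {p : W.left}

/-- The pullback of a section by germs of correspondences. -/
noncomputable def pullGerm (p : W.left) (t : (R.graph.op ⋙ F).obj (op X)) :
    (R.corLocal W p).obj X →+ (stalkFunctor W p).obj (R.graph.op ⋙ F) :=
  stalkDesc (P := R.zTr.obj X) (fun A => (germ (R.graph.op ⋙ F) A).comp ((pull F).flip t))
    fun A B f (a : R.Hom A.obj X) => by
      change germ _ B (pull F (R.comp (R.ofHom f.hom) a) t) = germ _ A (pull F a t)
      rw [pull_comp, pull_ofHom, germ_res]

lemma pullGerm_corGerm (t : (R.graph.op ⋙ F).obj (op X)) (A : NisNbhd W p) (a : R.Hom A.obj X) :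
    pullGerm F p t (R.corGerm A a) = germ (R.graph.op ⋙ F) A (pull F a t) :=
  stalkDesc_germ (P := R.zTr.obj X) _ _ A a

lemma pullGerm_corGermAt (t : (R.graph.op ⋙ F).obj (op X)) (a : R.Hom W X) :
    pullGerm F p t (R.corGermAt p a) = germAt (R.graph.op ⋙ F) p (pull F a t) :=
  pullGerm_corGerm F t (NisNbhd.trivial W p) a

lemma pullGerm_map (f : Y ⟶ X) (t : (R.graph.op ⋙ F).obj (op X)) (z : (R.corLocal W p).obj Y) :
    pullGerm F p ((R.graph.op ⋙ F).map f.op t) z = pullGerm F p t ((R.corLocal W p).map f z) := by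
  obtain ⟨A, a, rfl⟩ := R.exists_corGerm_eq z
  rw [corLocal_map_corGerm, pullGerm_corGerm, pullGerm_corGerm, pull_comp, pull_ofHom]

end Action

end Ringoid

namespace Ringoid
variable {R : Ringoid.{w} S}

/-! ### Locally bijective morphisms from presheaves with transfers -/

section LocallyBijective

variable (F : R.Corᵒᵖ ⥤ AddCommGrpCat.{v}) {G : (Sm S)ᵒᵖ ⥤ AddCommGrpCat.{v}}
  (φ : R.graph.op ⋙ F ⟶ G)

lemma map_map_eq {X Y Z : Sm S} (f : X ⟶ Y) (g : Y ⟶ Z) (s : G.obj (op Z)) :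
    G.map f.op (G.map g.op s) = G.map (f ≫ g).op s := by
  rw [op_comp, Functor.map_comp, ConcreteCategory.comp_apply]

lemma app_map {X Y : Sm S} (f : X ⟶ Y) (t : (R.graph.op ⋙ F).obj (op Y)) :
    φ.app (op X) ((R.graph.op ⋙ F).map f.op t) = G.map f.op (φ.app (op Y) t) :=
  NatTrans.naturality_apply φ f.op t

lemma exists_nbhd_lift [Presheaf.IsLocallySurjective (nisnevichTopology S) φ] {X : Sm S}
    (s : G.obj (op X)) (x : X.left) : ∃ (A : NisNbhd X x) (t : (R.graph.op ⋙ F).obj (op A.obj)),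
      φ.app (op A.obj) t = G.map A.map.op s :=
  exists_nbhd_of_mem (Presheaf.imageSieve_mem (nisnevichTopology S) φ s) x

lemma exists_nbhd_eq [Presheaf.IsLocallyInjective (nisnevichTopology S) φ] {X : Sm S}
    (t t' : (R.graph.op ⋙ F).obj (op X)) (h : φ.app (op X) t = φ.app (op X) t') (x : X.left) :
    ∃ A : NisNbhd X x, (R.graph.op ⋙ F).map A.map.op t = (R.graph.op ⋙ F).map A.map.op t' :=
  exists_nbhd_of_mem
    (Presheaf.equalizerSieve_mem (nisnevichTopology S) φ (X := op X) t t' h) x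

variable [F.Additive]

/-- By local injectivity t and t' agree on a neighbourhood B of the distinguished point of A, and
the component of c at A factors through B. -/
lemma pullGerm_corLocalLocalProj_eq [Presheaf.IsLocallyInjective (nisnevichTopology S) φ]
    {W X : Sm S} {p : W.left} {x : X.left} (A : NisNbhd X x)
    (t t' : (R.graph.op ⋙ F).obj (op A.obj)) (h : φ.app (op A.obj) t = φ.app (op A.obj) t')
    (c : R.corLocalLocal W p X x) :
    pullGerm F p t (R.corLocalLocalProj A c) = pullGerm F p t' (R.corLocalLocalProj A c) := by
  obtain ⟨B, hB⟩ := exists_nbhd_eq F φ t t' h A.pt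
  rw [← R.corLocal_map_corLocalLocalProj (A.compHom B) c]
  let z : (R.corLocal W p).obj B.obj := R.corLocalLocalProj (A.comp B) c
  change pullGerm F p t ((R.corLocal W p).map B.map z) =
    pullGerm F p t' ((R.corLocal W p).map B.map z)
  rw [← pullGerm_map, ← pullGerm_map, hB]

/-- Under (NL), germs of correspondences to `X` act on a section `s` of `G` on `X`, compatibly
with the action on the local lifts of `s`. -/
lemma NL.exists_pullGerm (hR : R.NL) [Presheaf.IsLocallyInjective (nisnevichTopology S) φ]
    [Presheaf.IsLocallySurjective (nisnevichTopology S) φ] {W X : Sm S} (p : W.left)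
    (s : G.obj (op X)) :
    ∃ Θ : (R.corLocal W p).obj X →+ (stalkFunctor W p).obj (R.graph.op ⋙ F),
      ∀ {Y : Sm S} (f : Y ⟶ X) (t : (R.graph.op ⋙ F).obj (op Y)),
        φ.app (op Y) t = G.map f.op s → ∀ z : (R.corLocal W p).obj Y,
          Θ ((R.corLocal W p).map f z) = pullGerm F p t z := by
  classical
  choose A t ht using fun x => exists_nbhd_lift F φ s x
  let e := AddEquiv.ofBijective _ (hR W p X)
  let θ (x : X.left) : R.corLocalLocal W p X x →+ (stalkFunctor W p).obj (R.graph.op ⋙ F) :=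
    (pullGerm F p (t x)).comp (R.corLocalLocalProj (A x))
  -- Injectivity in (NL) enters here: the components at the points x are well defined, so each may
  -- act through its own lift `t x`.
  let Θ : (R.corLocal W p).obj X →+ (stalkFunctor W p).obj (R.graph.op ⋙ F) :=
    (DirectSum.toAddMonoid θ).comp e.symm.toAddMonoidHom
  have hΘ (x : X.left) (c : R.corLocalLocal W p X x) :
      Θ (R.corLocalLocalMap W p X x c) = θ x c := by
    have he : R.corLocalLocalMap W p X x c = e (DirectSum.of _ x c) :=
      (DirectSum.toAddMonoid_of _ _ _).symm
    rw [he]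
    change DirectSum.toAddMonoid θ (e.symm (e _)) = _
    rw [AddEquiv.symm_apply_apply, DirectSum.toAddMonoid_of]
  refine ⟨Θ, fun {Y} f u hu z => ?_⟩
  obtain ⟨d, rfl⟩ := (hR W p Y).2 z
  induction d using DirectSum.induction_on with
  | zero => simp only [map_zero]
  | add d d' h h' => simp only [map_add, h, h']
  | of y c =>
    -- Both sides become the action of the component of c at the pullback along f of the
    -- neighbourhood `A (f y)`, on restrictions of `t (f y)` and of u. These two sections have the
    -- same image in G.
    rw [DirectSum.toAddMonoid_of, ← R.corLocalLocalMap_push f y rfl, hΘ]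
    change pullGerm F p (t _) (R.corLocalLocalProj (A _) _) = _
    rw [corLocalLocalProj_push, ← pullGerm_map,
      ← R.corLocal_map_corLocalLocalProj_eq_corLocalLocalMap (NisNbhd.pb f y rfl (A _)),
      ← pullGerm_map]
    apply pullGerm_corLocalLocalProj_eq F φ
    rw [app_map, app_map, ht, hu, map_map_eq, map_map_eq, NisNbhd.pb_condition]

variable {X : Sm S} (s : G.obj (op X))

/-- The group of pairs `(b, r)` generated by `(f ∘ a, φ (a^* t))` for the local lifts `t` of
`s`. -/
def pullRel (V : Sm S) : AddSubgroup (R.Hom V X × G.obj (op V)) :=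
  AddSubgroup.closure {z | ∃ (Y : Sm S) (f : Y ⟶ X) (a : R.Hom V Y)
    (t : (R.graph.op ⋙ F).obj (op Y)), φ.app (op Y) t = G.map f.op s ∧
      (R.comp a (R.ofHom f), φ.app (op V) (pull F a t)) = z}

variable {s}

lemma mem_pullRel {V Y : Sm S} {f : Y ⟶ X} (a : R.Hom V Y) {t : (R.graph.op ⋙ F).obj (op Y)}
    (h : φ.app (op Y) t = G.map f.op s) :
    (R.comp a (R.ofHom f), (φ.app (op V) (pull F a t) : G.obj (op V))) ∈ pullRel F φ s V :=
  AddSubgroup.subset_closure ⟨Y, f, a, t, h, rfl⟩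

lemma pullRel_res {V V' : Sm S} (g : V' ⟶ V) {b : R.Hom V X} {r : G.obj (op V)}
    (h : (b, r) ∈ pullRel F φ s V) :
    (R.comp (R.ofHom g) b, (G.map g.op r : G.obj (op V'))) ∈ pullRel F φ s V' := by
  have : pullRel F φ s V ≤ (pullRel F φ s V').comap
      ((R.compHom (R.ofHom g) X).prodMap (G.map g.op).hom) := by
    rw [pullRel, AddSubgroup.closure_le]
    rintro _ ⟨Y, f, a, t, ht, rfl⟩
    change (R.comp (R.ofHom g) (R.comp a (R.ofHom f)),
      (G.map g.op (φ.app (op V) (pull F a t)) : G.obj (op V'))) ∈ pullRel F φ s V'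
    rw [← R.assoc, ← app_map, ← pull_ofHom, ← pull_comp]
    exact mem_pullRel F φ _ ht
  exact this h

lemma exists_mem_pullRel {V : Sm S} {b : R.Hom V X}
    (hb : b ∈ R.sieveCor (Presheaf.imageSieve φ s) V) :
    ∃ r : G.obj (op V), (b, r) ∈ pullRel F φ s V := by
  have : R.sieveCor (Presheaf.imageSieve φ s) V ≤
      (pullRel F φ s V).map (AddMonoidHom.fst (R.Hom V X) (G.obj (op V))) := by
    rw [sieveCor, AddSubgroup.closure_le]
    rintro _ ⟨Y, f, a, ⟨t, ht⟩, rfl⟩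
    exact ⟨_, mem_pullRel F φ a ht, rfl⟩
  obtain ⟨⟨_, r⟩, h, rfl⟩ := this hb
  exact ⟨r, h⟩

/-- For b a sum of composites f ∘ a, the section m is the sum of the a^* t. Its germs depend on b
alone, since Θ does not see the decomposition. -/
lemma exists_germ_of_mem_pullRel {V : Sm S} {b : R.Hom V X} {r : G.obj (op V)}
    (h : (b, r) ∈ pullRel F φ s V)
    (Θ : ∀ p : V.left, (R.corLocal V p).obj X →+ (stalkFunctor V p).obj (R.graph.op ⋙ F))
    (hΘ : ∀ (p : V.left) {Y : Sm S} (f : Y ⟶ X) (t : (R.graph.op ⋙ F).obj (op Y)),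
      φ.app (op Y) t = G.map f.op s → ∀ z : (R.corLocal V p).obj Y,
        Θ p ((R.corLocal V p).map f z) = pullGerm F p t z) :
    ∃ m : (R.graph.op ⋙ F).obj (op V), φ.app (op V) m = r ∧ ∀ p : V.left,
      Θ p (R.corGermAt p b) =
        germAt (R.graph.op ⋙ F) p m := by
  have key : ∀ z ∈ pullRel F φ s V, ∃ m : (R.graph.op ⋙ F).obj (op V), φ.app (op V) m = z.2 ∧
      ∀ p : V.left, Θ p (R.corGermAt p z.1) =
        germAt (R.graph.op ⋙ F) p m := by
    intro z hz
    induction hz using AddSubgroup.closure_induction with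
    | mem z hz =>
      obtain ⟨Y, f, a, t, ht, rfl⟩ := hz
      refine ⟨pull F a t, rfl, fun p => ?_⟩
      rw [← pullGerm_corGermAt, ← hΘ p f t ht, corLocal_map_corGermAt]
    | zero =>
      refine ⟨0, map_zero _, fun p => ?_⟩
      rw [Prod.fst_zero, map_zero, map_zero, map_zero]
    | add z z' _ _ h h' =>
      obtain ⟨m, hm, k⟩ := h
      obtain ⟨m', hm', k'⟩ := h'
      refine ⟨m + m', by rw [map_add, hm, hm', Prod.snd_add], fun p => ?_⟩
      rw [Prod.fst_add, map_add, map_add, map_add, k, k']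
    | neg z _ h =>
      obtain ⟨m, hm, k⟩ := h
      refine ⟨-m, by rw [map_neg, hm, Prod.snd_neg], fun p => ?_⟩
      rw [Prod.fst_neg, map_neg, map_neg, map_neg, k]
  exact key _ h

end LocallyBijective

/-! ### Well-definedness and gluing of the pulled back section -/

section Sheaf

variable (F : R.Corᵒᵖ ⥤ AddCommGrpCat.{v}) [F.Additive] {G : (Sm S)ᵒᵖ ⥤ AddCommGrpCat.{v}}
  (φ : R.graph.op ⋙ F ⟶ G) (hG : Presieve.IsSheaf (nisnevichTopology S) (G ⋙ forget _))

include hG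

lemma sheaf_ext {X : Sm S} {Q : Sieve X} (hQ : Q ∈ nisnevichTopology S X) {s s' : G.obj (op X)}
    (h : ∀ {V : Sm S} (f : V ⟶ X), Q f → G.map f.op s = G.map f.op s') : s = s' :=
  ((hG Q hQ).isSeparatedFor).ext fun _ f hf => h f hf

lemma NL.eq_of_mem_pullRel (hR : R.NL) [Presheaf.IsLocallyInjective (nisnevichTopology S) φ]
    [Presheaf.IsLocallySurjective (nisnevichTopology S) φ] {X V : Sm S} {s : G.obj (op X)}
    {b : R.Hom V X} {r r' : G.obj (op V)} (h : (b, r) ∈ pullRel F φ s V)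
    (h' : (b, r') ∈ pullRel F φ s V) : r = r' := by
  choose Θ hΘ using fun p => hR.exists_pullGerm F φ (W := V) p s
  -- The difference is the pair (0, r - r'), so the section m of F over r - r' has zero germ at
  -- every point.
  have hz := sub_mem h h'
  rw [Prod.mk_sub_mk, sub_self] at hz
  obtain ⟨m, hm, k⟩ := exists_germ_of_mem_pullRel F φ hz Θ hΘ
  rw [← sub_eq_zero, ← hm]
  refine sheaf_ext hG (Q := Presheaf.equalizerSieve (X := op V) m 0)
    (mem_of_exists_nbhd fun p => ?_) fun f hf => ?_
  · have := k p
    rw [map_zero, map_zero] at this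
    obtain ⟨C, hC⟩ := exists_res_eq_zero_of_germAt_eq_zero _ this.symm
    exact ⟨C, hC.trans (map_zero _).symm⟩
  · rw [← app_map, (hf : (R.graph.op ⋙ F).map f.op m = (R.graph.op ⋙ F).map f.op 0), map_zero,
      map_zero, map_zero]

/-- The section obtained by gluing. -/
lemma NL.exists_glue (hR : R.NL) [Presheaf.IsLocallyInjective (nisnevichTopology S) φ]
    [Presheaf.IsLocallySurjective (nisnevichTopology S) φ] {X W : Sm S} (s : G.obj (op X))
    (b : R.Hom W X) : ∃ r : G.obj (op W), ∃ Q ∈ nisnevichTopology S W, ∀ {V : Sm S} (g : V ⟶ W),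
      Q g → (R.comp (R.ofHom g) b, (G.map g.op r : G.obj (op V))) ∈ pullRel F φ s V := by
  have hQ := hR.generationSieve_mem (Presheaf.imageSieve_mem (nisnevichTopology S) φ s) b
  choose r hr using fun (V : Sm S) (g : V ⟶ W)
    (hg : R.generationSieve (Presheaf.imageSieve φ s) b g) => exists_mem_pullRel F φ hg
  let x : Presieve.FamilyOfElements (G ⋙ forget _)
    (R.generationSieve (Presheaf.imageSieve φ s) b).arrows := r
  have hx : x.Compatible := by
    rw [Presieve.compatible_iff_sieveCompatible]
    intro V V' g k hg
    have h₁ := pullRel_res F φ k (hr V g hg)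
    rw [← R.assoc, ← R.ofHom_comp] at h₁
    -- The value chosen on V' and the restriction of the value chosen on V are related to the same
    -- correspondence.
    exact hR.eq_of_mem_pullRel F φ hG (hr V' (k ≫ g) _) h₁
  obtain ⟨t, ht, -⟩ := hG _ hQ x hx
  refine ⟨t, _, hQ, fun {V} g hg => ?_⟩
  have h := hr V g hg
  rwa [← (show G.map g.op t = r V g hg from ht g hg)] at h

end Sheaf

/-- A family of homomorphisms `b ↦ b^* s` which is natural and extends the action on the local
lifts of `s` through `φ`. -/
structure IsPullFamily (F : R.Corᵒᵖ ⥤ AddCommGrpCat.{v}) [F.Additive]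
    {G : (Sm S)ᵒᵖ ⥤ AddCommGrpCat.{v}} (φ : R.graph.op ⋙ F ⟶ G) {X : Sm S} (s : G.obj (op X))
    (T : ∀ W : Sm S, R.Hom W X →+ G.obj (op W)) : Prop where
  res : ∀ {V W : Sm S} (g : V ⟶ W) (b : R.Hom W X),
    T V (R.comp (R.ofHom g) b) = G.map g.op (T W b)
  lift : ∀ {V Y : Sm S} (f : Y ⟶ X) (a : R.Hom V Y) (t : (R.graph.op ⋙ F).obj (op Y)),
    φ.app (op Y) t = G.map f.op s → T V (R.comp a (R.ofHom f)) = φ.app (op V) (pull F a t)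

/-! ### Existence and uniqueness of the family b ↦ b^* s -/

section PullFamily

variable (F : R.Corᵒᵖ ⥤ AddCommGrpCat.{v}) [F.Additive] {G : (Sm S)ᵒᵖ ⥤ AddCommGrpCat.{v}}
  (φ : R.graph.op ⋙ F ⟶ G) (hG : Presieve.IsSheaf (nisnevichTopology S) (G ⋙ forget _))

include hG

lemma NL.exists_isPullFamily (hR : R.NL) [Presheaf.IsLocallyInjective (nisnevichTopology S) φ]
    [Presheaf.IsLocallySurjective (nisnevichTopology S) φ] {X : Sm S} (s : G.obj (op X)) :
    ∃ T : ∀ W : Sm S, R.Hom W X →+ G.obj (op W), IsPullFamily F φ s T := by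
  choose T Q hQ hT using fun (W : Sm S) (b : R.Hom W X) => hR.exists_glue F φ hG s b
  -- A section related to b on some cover equals the glued one; additivity, naturality and the
  -- values on lifts all follow from this.
  have key {W : Sm S} (b : R.Hom W X) (r : G.obj (op W)) (Q' : Sieve W)
      (hQ' : Q' ∈ nisnevichTopology S W) (h : ∀ {V : Sm S} (g : V ⟶ W), Q' g →
        (R.comp (R.ofHom g) b, (G.map g.op r : G.obj (op V))) ∈ pullRel F φ s V) : T W b = r :=
    sheaf_ext hG (GrothendieckTopology.intersection_covering _ (hQ W b) hQ') fun g hg =>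
      hR.eq_of_mem_pullRel F φ hG (hT W b g hg.1) (h g hg.2)
  refine ⟨fun W => AddMonoidHom.mk' (T W) fun b b' => key _ _ _
    (GrothendieckTopology.intersection_covering _ (hQ W b) (hQ W b')) fun g hg => ?_, ?_, ?_⟩
  · rw [R.comp_add, map_add]
    exact add_mem (hT W b g hg.1) (hT W b' g hg.2)
  · intro V W g b
    refine key _ _ _ ((nisnevichTopology S).pullback_stable g (hQ W b)) fun k hk => ?_
    rw [map_map_eq, ← R.assoc, ← R.ofHom_comp]
    exact hT W b _ hk
  · intro V Y f a t ht
    exact key _ _ _ ((nisnevichTopology S).top_mem V) fun g _ =>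
      pullRel_res F φ g (mem_pullRel F φ a ht)

/-- Natural homomorphisms on correspondences to `X` with values in a sheaf are determined by the
correspondences that factor through a covering sieve. -/
lemma NL.hom_ext (hR : R.NL) {X : Sm S} {Q : Sieve X} (hQ : Q ∈ nisnevichTopology S X)
    (T T' : ∀ W : Sm S, R.Hom W X →+ G.obj (op W))
    (hT : ∀ {V W : Sm S} (g : V ⟶ W) (b : R.Hom W X),
      T V (R.comp (R.ofHom g) b) = G.map g.op (T W b))
    (hT' : ∀ {V W : Sm S} (g : V ⟶ W) (b : R.Hom W X),
      T' V (R.comp (R.ofHom g) b) = G.map g.op (T' W b))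
    (h : ∀ {V Y : Sm S} (f : Y ⟶ X) (a : R.Hom V Y), Q f →
      T V (R.comp a (R.ofHom f)) = T' V (R.comp a (R.ofHom f))) (W : Sm S) : T W = T' W := by
  ext b
  -- On this cover of W the correspondence b is a sum of composites through Q, where the two
  -- families agree.
  refine sheaf_ext hG (hR.generationSieve_mem hQ b) fun {V} g hg => ?_
  rw [← hT, ← hT']
  have : R.sieveCor Q V ≤ (T V).eqLocus (T' V) := by
    rw [sieveCor, AddSubgroup.closure_le]
    rintro _ ⟨Y, f, a, hf, rfl⟩
    exact h f a hf
  exact this hg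

lemma IsPullFamily.unique (hR : R.NL)
    [Presheaf.IsLocallySurjective (nisnevichTopology S) φ] {X : Sm S} {s : G.obj (op X)}
    {T T' : ∀ W : Sm S, R.Hom W X →+ G.obj (op W)} (h : IsPullFamily F φ s T)
    (h' : IsPullFamily F φ s T') (W : Sm S) : T W = T' W :=
  hR.hom_ext hG (Presheaf.imageSieve_mem (nisnevichTopology S) φ s) T T' h.res h'.res
    (fun f a ⟨t, ht⟩ => (h.lift f a t ht).trans (h'.lift f a t ht).symm) W

end PullFamily

end Ringoid

namespace Ringoid
variable {R : Ringoid.{w} S}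

/-! ### The transfer structure on the target -/

section Transfer

variable (F : R.Corᵒᵖ ⥤ AddCommGrpCat.{v}) [F.Additive] {G : (Sm S)ᵒᵖ ⥤ AddCommGrpCat.{v}}
  (φ : R.graph.op ⋙ F ⟶ G) [Presheaf.IsLocallyInjective (nisnevichTopology S) φ]
  [Presheaf.IsLocallySurjective (nisnevichTopology S) φ]
  (hG : Presieve.IsSheaf (nisnevichTopology S) (G ⋙ forget _)) (hR : R.NL)

/-- The pullbacks of a section of `G` by correspondences. -/
noncomputable def pullSection {X : Sm S} (s : G.obj (op X)) (W : Sm S) :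
    R.Hom W X →+ G.obj (op W) :=
  (hR.exists_isPullFamily F φ hG s).choose W

lemma isPullFamily_pullSection {X : Sm S} (s : G.obj (op X)) :
    IsPullFamily F φ s (pullSection F φ hG hR s) :=
  (hR.exists_isPullFamily F φ hG s).choose_spec

lemma pullSection_add {X : Sm S} (s s' : G.obj (op X)) (W : Sm S) :
    pullSection F φ hG hR (s + s') W =
      pullSection F φ hG hR s W + pullSection F φ hG hR s' W := by
  have h := isPullFamily_pullSection F φ hG hR s
  have h' := isPullFamily_pullSection F φ hG hR s'
  have h'' := isPullFamily_pullSection F φ hG hR (s + s')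
  refine hR.hom_ext hG (GrothendieckTopology.intersection_covering _
    (Presheaf.imageSieve_mem (nisnevichTopology S) φ s)
    (Presheaf.imageSieve_mem (nisnevichTopology S) φ s'))
    (pullSection F φ hG hR (s + s'))
    (fun W => pullSection F φ hG hR s W + pullSection F φ hG hR s' W) h''.res
    (fun g b => ?_) ?_ W
  · rw [AddMonoidHom.add_apply, AddMonoidHom.add_apply, map_add, h.res, h'.res]
  · rintro V Y f a ⟨⟨t, ht⟩, ⟨t', ht'⟩⟩
    rw [AddMonoidHom.add_apply, h.lift f a t ht, h'.lift f a t' ht', h''.lift f a (t + t')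
      ((map_add _ _ _).trans ((congrArg₂ _ ht ht').trans (map_add _ _ _).symm)),
      map_add, map_add]

lemma pullSection_app {X W : Sm S} (t : (R.graph.op ⋙ F).obj (op X)) (b : R.Hom W X) :
    pullSection F φ hG hR (φ.app (op X) t) W b = φ.app (op W) (pull F b t) := by
  have h := (isPullFamily_pullSection F φ hG hR (φ.app (op X) t)).lift (𝟙 X) b t
    (ConcreteCategory.congr_hom (G.map_id (op X)) _).symm
  rwa [R.ofHom_id, R.comp_id] at h

lemma pullSection_ofHom {X W : Sm S} (s : G.obj (op X)) (f : W ⟶ X) :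
    pullSection F φ hG hR s W (R.ofHom f) = G.map f.op s := by
  have h := isPullFamily_pullSection F φ hG hR s
  refine sheaf_ext hG ((nisnevichTopology S).pullback_stable f
    (Presheaf.imageSieve_mem (nisnevichTopology S) φ s)) fun {V} g hg => ?_
  obtain ⟨t, ht⟩ := hg
  -- The rule for lifts is applied with the identity correspondence of V as a.
  rw [← h.res, ← R.ofHom_comp, ← R.id_comp (R.ofHom (g ≫ f)), h.lift (g ≫ f) _ t ht, map_map_eq,
    ← ht, pull_id]

/-- A single t must serve for all a at once: c^* s lifts to F, and pulling it back along a is the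
action of F on this lift. This is functoriality for composites with c. -/
lemma exists_lift_pullSection {X V : Sm S} (s : G.obj (op X)) {c : R.Hom V X}
    (hc : c ∈ R.sieveCor (Presheaf.imageSieve φ s) V) :
    ∃ t : (R.graph.op ⋙ F).obj (op V), φ.app (op V) t = pullSection F φ hG hR s V c ∧
      ∀ {W : Sm S} (a : R.Hom W V),
        φ.app (op W) (pull F a t) = pullSection F φ hG hR s W (R.comp a c) := by
  have h := isPullFamily_pullSection F φ hG hR s
  suffices H : ∃ t : (R.graph.op ⋙ F).obj (op V), ∀ {W : Sm S} (a : R.Hom W V),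
      φ.app (op W) (pull F a t) = pullSection F φ hG hR s W (R.comp a c) by
    obtain ⟨t, ht⟩ := H
    refine ⟨t, ?_, ht⟩
    have := ht (R.id V)
    rwa [R.id_comp, pull_id] at this
  induction hc using AddSubgroup.closure_induction with
  | mem c hc =>
    obtain ⟨Y, f, b, ⟨t, ht⟩, rfl⟩ := hc
    refine ⟨pull F b t, fun {W} a => ?_⟩
    rw [← R.assoc, h.lift f _ t ht, pull_comp]
  | zero =>
    refine ⟨0, fun {W} a => ?_⟩
    have e : R.comp a 0 = 0 := (R.compHom a X).map_zero
    rw [map_zero, map_zero, e, map_zero]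
  | add c c' _ _ h₁ h₂ =>
    obtain ⟨t, ht⟩ := h₁
    obtain ⟨t', ht'⟩ := h₂
    refine ⟨t + t', fun {W} a => ?_⟩
    rw [map_add, map_add, R.comp_add, map_add, ht, ht']
  | neg c _ h₁ =>
    obtain ⟨t, ht⟩ := h₁
    refine ⟨-t, fun {W} a => ?_⟩
    have e : R.comp a (-c) = -R.comp a c := (R.compHom a X).map_neg c
    rw [map_neg, map_neg, e, map_neg, ht]

/-- Both sides are natural in W and additive in a, so a may be taken to factor through some f : Z ⟶
Y for which b ∘ f is a sum of correspondences through local lifts of s. -/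
lemma pullSection_comp {X Y W : Sm S} (s : G.obj (op X)) (a : R.Hom W Y) (b : R.Hom Y X) :
    pullSection F φ hG hR s W (R.comp a b) =
      pullSection F φ hG hR (pullSection F φ hG hR s Y b) W a := by
  have h := isPullFamily_pullSection F φ hG hR s
  have h' := isPullFamily_pullSection F φ hG hR (pullSection F φ hG hR s Y b)
  let T (W : Sm S) : R.Hom W Y →+ G.obj (op W) :=
    AddMonoidHom.mk' (fun a => pullSection F φ hG hR s W (R.comp a b)) fun a a' => by
      rw [R.add_comp, map_add]
  refine DFunLike.congr_fun (hR.hom_ext hG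
    (hR.generationSieve_mem (Presheaf.imageSieve_mem (nisnevichTopology S) φ s) b) T
    (pullSection F φ hG hR (pullSection F φ hG hR s Y b)) (fun g c => ?_) h'.res ?_ W) a
  · change pullSection F φ hG hR s _ (R.comp (R.comp _ c) b) = _
    rw [R.assoc, h.res]
    rfl
  · intro V Z f c hf
    obtain ⟨t, ht, hta⟩ := exists_lift_pullSection F φ hG hR s hf
    rw [h.res] at ht
    rw [h'.lift f c t ht, hta, ← R.assoc]
    rfl

/-- The transfer structure on the target of a locally bijective morphism to a sheaf. -/
noncomputable def transferStructure : R.TransferStructure G where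
  map {X Y} := AddMonoidHom.flip (AddMonoidHom.mk' (fun s => pullSection F φ hG hR s X)
    fun s s' => pullSection_add F φ hG hR s s' X)
  map_ofHom f := by
    ext s
    exact pullSection_ofHom F φ hG hR s f
  map_comp a b := by
    ext s
    exact pullSection_comp F φ hG hR s a b

/-- The morphism of presheaves with transfers to the target of a locally bijective morphism. -/
noncomputable def toTransferStructure : F ⟶ (transferStructure F φ hG hR).toFunctor where
  app X := φ.app (op X.unop.sch)
  naturality X Y a := AddCommGrpCat.hom_ext (AddMonoidHom.ext fun t =>
    (pullSection_app F φ hG hR (X := X.unop.sch) (W := Y.unop.sch) t a.unop).symm)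

include hG hR in
lemma existsUnique_transferStructure :
    ∃! t : R.TransferStructure G, ∃ ν : F ⟶ t.toFunctor, ∀ X : Sm S,
      ν.app (op (R.graph.obj X)) = φ.app (op X) := by
  refine ⟨transferStructure F φ hG hR, ⟨toTransferStructure F φ hG hR, fun _ => rfl⟩, ?_⟩
  rintro t ⟨ν, hν⟩
  ext X Y a s
  -- Any transfer structure compatible with φ gives such a family for each s, so uniqueness of
  -- families applies.
  have h : IsPullFamily F φ s (fun W => t.map.flip s) :=
    { res := fun g b => by
        change t.map (R.comp _ b) s = _
        rw [t.map_comp, t.map_ofHom]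
        rfl
      lift := fun {V Z} f a u hu => by
        change t.map (R.comp a _) s = _
        rw [t.map_comp, t.map_ofHom]
        change t.map a (G.map f.op s) = _
        rw [← hu, ← hν, ← hν]
        exact (NatTrans.naturality_apply ν
          (Quiver.Hom.op (X := R.graph.obj V) (Y := R.graph.obj Z) a) u).symm }
  exact DFunLike.congr_fun
    (h.unique F φ hG hR (isPullFamily_pullSection F φ hG hR s) X) a

end Transfer

end Ringoid
end NisTransfers

theorem mainTheorem8 (S : Scheme.{u}) [IsNoetherian S] [S.IsSeparated]
    (R : NisTransfers.Ringoid.{w} S) (hR : R.NL)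
    (F : R.Corᵒᵖ ⥤ AddCommGrpCat.{max v (u + 1)}) [F.Additive] :
    ∃! t : R.TransferStructure
        (sheafify (NisTransfers.nisnevichTopology S) (R.graph.op ⋙ F)),
      ∃ ν : F ⟶ t.toFunctor, ∀ X : NisTransfers.Sm S,
        ν.app (op (R.graph.obj X)) =
          (toSheafify (NisTransfers.nisnevichTopology S) (R.graph.op ⋙ F)).app (op X) := by
  refine NisTransfers.Ringoid.existsUnique_transferStructure F _ ?_ hR
  -- Limits of the size of `Sm S` are needed to pass from sheaves of groups to sheaves of sets.
  have : PreservesLimitsOfSize.{u, u + 1} (forget AddCommGrpCat.{max v (u + 1)}) :=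
    preservesLimitsOfSize_shrink.{u + 1, max v (u + 1), u, max v (u + 1)} _
  have : HasLimitsOfSize.{u, u + 1} AddCommGrpCat.{max v (u + 1)} :=
    hasLimitsOfSizeShrink.{u, u + 1, max v (u + 1), max v (u + 1)} _
  rw [← isSheaf_iff_isSheaf_of_type, ← Presheaf.isSheaf_iff_isSheaf_comp]
  exact ((presheafToSheaf (NisTransfers.nisnevichTopology S) _).obj _).property
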